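/- Let $X\in\mathbb{R}^{n\times p}$, $y\in\mathbb{R}^n$, $\lambda,\mu\ge 0$, let $k\ge 1$ be an integer, put $Q=X^\top X+\lambda I$ and $P=\{1,\dots,p\}$, and let $V_1,\dots,V_{\min\{n,p\}}\in\mathbb{R}^p$ be eigenvectors of $X^\top X$. Let $\mathcal{P}=\{T\subseteq P:|T|\le 2\}$, $z(T)=\sum_{i\in T}z_i$, and for $z\in[0,1]^p$, $\beta\in\mathbb{R}^p$ let $$\underline{\phi_{\mathcal P}}(z,\beta)=\sup\Big\{\beta^\top R\beta+\sum_{T\in\mathcal P}\frac{\beta^\top A_T\beta}{\min\{1,z(T)\}}\Big\}\in[-\infty,+\infty],$$ the supremum being over all positive semidefinite $A_T\in\mathbb{R}^{p\times p}$ ($T\in\mathcal P$) whose entries outside $T\times T$ vanish and all $R=\sum_{j=1}^{\min\{n,p\}}\pi_jV_jV_j^\top$ with $\pi\ge 0$ such that $\sum_{T\in\mathcal P}A_T+R=Q$; here $s/0=\infty$ for $s>0$, $0/0=0$, and $\sup\emptyset=-\infty$. Consider the relaxation $$\text{(REL)}\qquad y^\top y+\inf\ -2y^\top X\beta+\mu\,e^\top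 u+\underline{\phi_{\mathcal P}}(z,\beta)\quad\text{s.t.}\quad e^\top z\le k,\ \ -u\le\beta\le u,\ \ z\in[0,1]^p,\ u\in\mathbb{R}^p_+,\ \beta\in\mathbb{R}^p,$$ where $e$ is the all-ones vector, and the problem $$\begin{aligned}(\mathrm{SDP}_{LB})\qquad y^\top y+\inf\ & -2y^\top X\beta+\mu\,e^\top u+\langle Q,B\rangle\\ \text{s.t. }& e^\top z\le k,\quad -u\le\beta\le u,\\ &\begin{pmatrix}z_i&\beta_i\\ \beta_i&B_{ii}\end{pmatrix}\succeq 0\quad(i=1,\dots,p),\\ &0\le w_{ij}\le\min\{1,z_i+z_j\},\quad \begin{pmatrix}w_{ij}&\beta_i&\beta_j\\ \beta_i&B_{ii}&B_{ij}\\ \beta_j&B_{ij}&B_{jj}\end{pmatrix}\succeq 0\quad(i<j),\\ &V_j^\top(B-\beta\beta^\top)V_j\ge 0\quad(j=1,\dots,\min\{n,p\}),\\ &\beta\in\mathbb{R}^p,\ z\in[0,1]^p,\ u\in\mathbb{R}^p_+,\ B\in\mathbb{R}^{p\times p}\text{ symmetric}.\end{aligned}$$ Then (REL) and $(\mathrm{SDP}_{LB})$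 are equivalent in the following sense. (1) They have the same optimal value. (2) For all $\beta\in\mathbb{R}^p$ and $z\in[0,1]^p$ such that $\beta_i=0$ whenever $z_i=0$, there are $(w,B)$ that satisfy the constraints of $(\mathrm{SDP}_{LB})$ involving $w$ or $B$, and $\underline{\phi_{\mathcal P}}(z,\beta)$ is the infimum of $\langle Q,B\rangle$ over all such $(w,B)$. (3) If $(\beta,z,u,w,B)$ is an optimal solution of $(\mathrm{SDP}_{LB})$, then $(\beta,z,u)$ is an optimal solution of (REL). -/

import Mathlib

open scoped Matrix

noncomputable section

namespace SparseReg

/-- The quotient `s / d` of nonnegative reals with the convention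
`s / 0 = ∞` for `s > 0` and `0 / 0 = 0`. -/
def ratio (s d : ℝ) : EReal :=
  if d = 0 then (if 0 < s then ⊤ else 0) else ((s / d : ℝ) : EReal)

/-- The matrix `XᵀX + lam I`. -/
def gram {n p : ℕ} (X : Matrix (Fin n) (Fin p) ℝ) (lam : ℝ) : Matrix (Fin p) (Fin p) ℝ :=
  Xᵀ * X + lam • (1 : Matrix (Fin p) (Fin p) ℝ)

/-- The quadratic form `βᵀ M β`. -/
def quad {p : ℕ} (M : Matrix (Fin p) (Fin p) ℝ) (β : Fin p → ℝ) : ℝ :=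
  β ⬝ᵥ (M *ᵥ β)

/-- The entrywise inner product of two matrices. -/
def matInner {p : ℕ} (M N : Matrix (Fin p) (Fin p) ℝ) : ℝ :=
  ∑ i, ∑ j, M i j * N i j

/-- `(A, R, π)` is feasible for the decomposition problem: `Q = ∑_{T ∈ Fam} A_T + R`, where each
`A_T` is positive semidefinite and vanishes off `T × T`, and
`R = V diag(π) Vᵀ = ∑ⱼ πⱼ Vⱼ Vⱼᵀ` with `π ≥ 0`, `Vⱼ` being the columns of `V`. -/
structure IsDecomposition {p m : ℕ} (Fam : Finset (Finset (Fin p)))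
    (Q : Matrix (Fin p) (Fin p) ℝ) (V : Matrix (Fin p) (Fin m) ℝ)
    (A : Finset (Fin p) → Matrix (Fin p) (Fin p) ℝ) (R : Matrix (Fin p) (Fin p) ℝ)
    (π : Fin m → ℝ) : Prop where
  sum_eq : ∑ T ∈ Fam, A T + R = Q
  supp : ∀ T ∈ Fam, ∀ i j, (i ∉ T ∨ j ∉ T) → A T i j = 0
  psd : ∀ T ∈ Fam, (A T).PosSemidef
  rem_eq : R = V * Matrix.diagonal π * Vᵀ
  nonneg : ∀ j, 0 ≤ π j

/-- The function `φ(z, β)` for the family `Fam`: the supremum of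
`βᵀ R β + ∑_{T ∈ Fam} (β_Tᵀ A_T β_T) / min {1, z(T)}` over all feasible decompositions. -/
def phi {p m : ℕ} (Fam : Finset (Finset (Fin p))) (Q : Matrix (Fin p) (Fin p) ℝ)
    (V : Matrix (Fin p) (Fin m) ℝ) (z β : Fin p → ℝ) : EReal :=
  ⨆ (A : Finset (Fin p) → Matrix (Fin p) (Fin p) ℝ) (R : Matrix (Fin p) (Fin p) ℝ)
    (π : Fin m → ℝ) (_ : IsDecomposition Fam Q V A R π),
    ((quad R β : ℝ) : EReal) + ∑ T ∈ Fam, ratio (quad (A T) β) (min 1 (∑ i ∈ T, z i))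

/-- The constraints on `(β, z, u)` shared by both problems. -/
structure BaseFeasible {p : ℕ} (k : ℕ) (β z u : Fin p → ℝ) : Prop where
  card : ∑ i, z i ≤ k
  le_u : ∀ i, β i ≤ u i
  neg_le_u : ∀ i, -β i ≤ u i
  z_mem : ∀ i, z i ∈ Set.Icc (0 : ℝ) 1
  u_nonneg : ∀ i, 0 ≤ u i

/-- The part `-2 yᵀ X β + mu eᵀ u` of the objective shared by both problems. -/
def linObj {n p : ℕ} (X : Matrix (Fin n) (Fin p) ℝ) (y : Fin n → ℝ) (mu : ℝ)
    (β u : Fin p → ℝ) : ℝ :=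
  -2 * (y ⬝ᵥ (X *ᵥ β)) + mu * ∑ i, u i

/-- The objective of the relaxation in the original space of variables (with `yᵀy`). -/
def relaxObj {n p m : ℕ} (X : Matrix (Fin n) (Fin p) ℝ) (y : Fin n → ℝ) (lam mu : ℝ)
    (Fam : Finset (Finset (Fin p))) (V : Matrix (Fin p) (Fin m) ℝ)
    (β z u : Fin p → ℝ) : EReal :=
  ((y ⬝ᵥ y + linObj X y mu β u : ℝ) : EReal) + phi Fam (gram X lam) V z β

/-- The optimal value of the relaxation in the original space of variables. -/
def relaxValue {n p m : ℕ} (X : Matrix (Fin n) (Fin p) ℝ) (y : Fin n → ℝ) (lam mu : ℝ) (k : ℕ)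
    (Fam : Finset (Finset (Fin p))) (V : Matrix (Fin p) (Fin m) ℝ) : EReal :=
  ⨅ (β : Fin p → ℝ) (z : Fin p → ℝ) (u : Fin p → ℝ) (_ : BaseFeasible k β z u),
    relaxObj X y lam mu Fam V β z u

/-- The constraints of `SDP_LB` that involve `w` or `B`, at given `(β, z)`.
Only the entries `w i j` with `i < j` matter. -/
structure InnerFeasible {p m : ℕ} (V : Matrix (Fin p) (Fin m) ℝ) (β z : Fin p → ℝ)
    (w : Fin p → Fin p → ℝ) (B : Matrix (Fin p) (Fin p) ℝ) : Prop where
  symm : B.IsSymm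
  psd_two : ∀ i, (!![z i, β i; β i, B i i] : Matrix (Fin 2) (Fin 2) ℝ).PosSemidef
  w_nonneg : ∀ i j, i < j → 0 ≤ w i j
  w_le : ∀ i j, i < j → w i j ≤ min 1 (z i + z j)
  psd_three : ∀ i j, i < j →
    (!![w i j, β i, β j;
        β i, B i i, B i j;
        β j, B i j, B j j] : Matrix (Fin 3) (Fin 3) ℝ).PosSemidef
  rank_one : ∀ j : Fin m, 0 ≤ quad (B - Matrix.vecMulVec β β) (fun i => V i j)

/-- The objective of `SDP_LB` (with `yᵀy`). -/
def sdpObj {n p : ℕ} (X : Matrix (Fin n) (Fin p) ℝ) (y : Fin n → ℝ) (lam mu : ℝ)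
    (β u : Fin p → ℝ) (B : Matrix (Fin p) (Fin p) ℝ) : ℝ :=
  y ⬝ᵥ y + linObj X y mu β u + matInner (gram X lam) B

/-- The optimal value of `SDP_LB`. -/
def sdpValue {n p m : ℕ} (X : Matrix (Fin n) (Fin p) ℝ) (y : Fin n → ℝ) (lam mu : ℝ) (k : ℕ)
    (V : Matrix (Fin p) (Fin m) ℝ) : EReal :=
  ⨅ (β : Fin p → ℝ) (z : Fin p → ℝ) (u : Fin p → ℝ) (w : Fin p → Fin p → ℝ)
    (B : Matrix (Fin p) (Fin p) ℝ) (_ : BaseFeasible k β z u) (_ : InnerFeasible V β z w B),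
    ((sdpObj X y lam mu β u B : ℝ) : EReal)

/-- The optimal value of the minimization of `⟨XᵀX + lam I, B⟩` over the variables `(w, B)` of
`SDP_LB`, at given `(β, z)`. -/
def innerValue {n p m : ℕ} (X : Matrix (Fin n) (Fin p) ℝ) (lam : ℝ)
    (V : Matrix (Fin p) (Fin m) ℝ) (β z : Fin p → ℝ) : EReal :=
  ⨅ (w : Fin p → Fin p → ℝ) (B : Matrix (Fin p) (Fin p) ℝ) (_ : InnerFeasible V β z w B),
    ((matInner (gram X lam) B : ℝ) : EReal)

/-- The family of all subsets of size at most two. -/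
def pairs (p : ℕ) : Finset (Finset (Fin p)) :=
  Finset.univ.filter (fun T => T.card ≤ 2)

end SparseReg

end

/-! For fixed `(z, β)` such that `β` vanishes where `z` does, `phi` is the value of a linear conic
program in `(A, π)`. Its dual minimizes `⟨Q, B⟩` over the matrices `B` of `Dominates`. Schur
complements turn these constraints into those of the SDP, with `w` eliminated by giving it its
largest value (`InnerFeasible.dominates`, `Dominates.innerFeasible`).

Strong duality (`exists_isDecomposition_le`) needs no Slater point. Positive semidefinite pieces sum
to zero only if each one is zero, so the image of the cone of decompositions is closed and Farkas'
lemma is exact. The dual is always feasible, through a multiple of `ββᵀ`. Hence the two values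
agree, `-∞` included.

Equality of the optimal values must also cover points of the relaxation with `z i = 0` and `β i ≠
0`, over which the SDP has no feasible point. Pulling such a point slightly towards `(0, 1 / (p +
1), 0)` makes `z` positive without increasing `phi` (`phi_smul_le`), and the linear part of the
objective is continuous along the way. -/

/-! ### Closed images of cones and Farkas' lemma -/

section ClosedCone

open Filter Topology

variable {E F : Type*} [NormedAddCommGroup E] [NormedSpace ℝ E] [ProperSpace E]
  [NormedAddCommGroup F] [NormedSpace ℝ F]

/-- A linear map that vanishes on a closed cone only at the apex is bounded below on it. -/
theorem ProperCone.exists_norm_le_mul_norm_apply (K : ProperCone ℝ E) (f : E →L[ℝ] F)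
    (hf : ∀ x ∈ K, f x = 0 → x = 0) : ∃ C : ℝ, ∀ x ∈ K, ‖x‖ ≤ C * ‖f x‖ := by
  have hcompact : IsCompact ((K : Set E) ∩ Metric.sphere 0 1) :=
    (isCompact_sphere 0 1).inter_left K.isClosed
  rcases ((K : Set E) ∩ Metric.sphere 0 1).eq_empty_or_nonempty with hempty | hne
  · refine ⟨0, fun x hx ↦ ?_⟩
    by_contra hpos
    have hx0 : 0 < ‖x‖ := by simpa using hpos
    have : (‖x‖⁻¹ • x) ∈ (K : Set E) ∩ Metric.sphere 0 1 :=
      ⟨K.toPointedCone.smul_mem (by positivity) hx, by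
        simp [norm_smul, hx0.ne']⟩
    simp [hempty] at this
  -- The least value of `‖f x‖` on the unit vectors of the cone is positive, and `C` is its inverse.
  · obtain ⟨x₀, ⟨hx₀, hs₀⟩, hmin⟩ :=
      hcompact.exists_isMinOn hne (f.continuous.norm.continuousOn)
    have hx₀' : ‖x₀‖ = 1 := by simpa using hs₀
    have hm : 0 < ‖f x₀‖ := by
      refine norm_pos_iff.2 fun h ↦ ?_
      simp [hf x₀ hx₀ h] at hx₀'
    refine ⟨‖f x₀‖⁻¹, fun x hx ↦ ?_⟩
    rcases eq_or_ne x 0 with rfl | hx0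
    · simp
    have hxpos : 0 < ‖x‖ := norm_pos_iff.2 hx0
    have hmem : (‖x‖⁻¹ • x) ∈ (K : Set E) ∩ Metric.sphere 0 1 :=
      ⟨K.toPointedCone.smul_mem (by positivity) hx, by
        simp [norm_smul, hxpos.ne']⟩
    have h := hmin hmem
    simp only [Set.mem_ofPred_eq, map_smul, norm_smul, norm_inv, norm_norm] at h
    rw [inv_mul_eq_div, le_div_iff₀ hxpos] at h
    rw [inv_mul_eq_div, le_div_iff₀ hm]
    linarith

/-- The lower bound on `f` makes preimages of a convergent sequence bounded, so a subsequence of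
them converges inside the closed cone. -/
theorem ProperCone.isClosed_image (K : ProperCone ℝ E) (f : E →L[ℝ] F)
    (hf : ∀ x ∈ K, f x = 0 → x = 0) : IsClosed (f '' (K : Set E)) := by
  obtain ⟨C, hC⟩ := K.exists_norm_le_mul_norm_apply f hf
  refine isClosed_of_closure_subset fun y hy ↦ ?_
  obtain ⟨v, hv, hlim⟩ := mem_closure_iff_seq_limit.1 hy
  choose x hxK hxv using hv
  have hlim' : Tendsto (fun n ↦ f (x n)) atTop (𝓝 y) := by simpa [hxv] using hlim
  obtain ⟨M, hM⟩ := (Metric.isBounded_range_of_tendsto _ hlim').exists_norm_le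
  have hb : Bornology.IsBounded (Set.range x) := by
    refine isBounded_iff_forall_norm_le.2 ⟨|C| * M, ?_⟩
    rintro _ ⟨n, rfl⟩
    exact (hC _ (hxK n)).trans (mul_le_mul (le_abs_self C) (hM _ ⟨n, rfl⟩) (norm_nonneg _)
      (abs_nonneg C))
  obtain ⟨a, -, φ, hφ, ha⟩ := tendsto_subseq_of_bounded hb (fun n ↦ Set.mem_range_self n)
  refine ⟨a, K.isClosed.mem_of_tendsto ha (Eventually.of_forall fun n ↦ hxK _), ?_⟩
  exact tendsto_nhds_unique ((f.continuous.tendsto a).comp ha) (hlim'.comp hφ.tendsto_atTop)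

/-- Farkas' lemma for the image of a closed cone under a linear map that vanishes on it only at the
apex. -/
theorem ProperCone.exists_apply_eq_of_forall_dual (K : ProperCone ℝ E) (f : E →L[ℝ] F)
    (hf : ∀ x ∈ K, f x = 0 → x = 0) (y : F)
    (h : ∀ g : StrongDual ℝ F, (∀ x ∈ K, 0 ≤ g (f x)) → 0 ≤ g y) : ∃ x ∈ K, f x = y := by
  have hcl : (K.map f : Set F) = (f '' (K : Set E)) := by
    change closure (f '' (K : Set E)) = _
    exact (K.isClosed_image f hf).closure_eq
  by_contra hy
  obtain ⟨g, hg, hgy⟩ := (K.map f).hyperplane_separation_point (x₀ := y) (by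
    rw [← SetLike.mem_coe, hcl]
    exact hy)
  refine hgy.not_ge (h g fun x hx ↦ hg _ ?_)
  rw [← SetLike.mem_coe, hcl]
  exact ⟨x, hx, rfl⟩

end ClosedCone

namespace SparseReg

/-! ### Quadratic forms and the entrywise inner product -/

section Algebra

variable {p m : ℕ}

theorem quad_eq_sum (M : Matrix (Fin p) (Fin p) ℝ) (x : Fin p → ℝ) :
    quad M x = ∑ i, ∑ j, x i * x j * M i j := by
  simp only [quad, dotProduct, Matrix.mulVec, Finset.mul_sum]
  exact Finset.sum_congr rfl fun i _ ↦ Finset.sum_congr rfl fun j _ ↦ by ring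

theorem quad_add (M N : Matrix (Fin p) (Fin p) ℝ) (x : Fin p → ℝ) :
    quad (M + N) x = quad M x + quad N x := by
  simp [quad, Matrix.add_mulVec]

theorem quad_sub (M N : Matrix (Fin p) (Fin p) ℝ) (x : Fin p → ℝ) :
    quad (M - N) x = quad M x - quad N x := by
  simp [quad, Matrix.sub_mulVec]

theorem quad_smul (c : ℝ) (M : Matrix (Fin p) (Fin p) ℝ) (x : Fin p → ℝ) :
    quad (c • M) x = c * quad M x := by
  simp [quad, Matrix.smul_mulVec]

theorem quad_vecMulVec (x y : Fin p → ℝ) : quad (Matrix.vecMulVec y y) x = (x ⬝ᵥ y) ^ 2 := by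
  rw [quad_eq_sum, sq, dotProduct, Finset.sum_mul_sum]
  exact Finset.sum_congr rfl fun i _ ↦ Finset.sum_congr rfl fun j _ ↦ by
    rw [Matrix.vecMulVec_apply]; ring

theorem matInner_vecMulVec (x : Fin p → ℝ) (B : Matrix (Fin p) (Fin p) ℝ) :
    matInner (Matrix.vecMulVec x x) B = quad B x := by
  simp only [matInner, quad_eq_sum, Matrix.vecMulVec_apply]

theorem matInner_comm (M N : Matrix (Fin p) (Fin p) ℝ) : matInner M N = matInner N M := by
  simp only [matInner, mul_comm]

theorem quad_eq_matInner (M : Matrix (Fin p) (Fin p) ℝ) (x : Fin p → ℝ) :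
    quad M x = matInner M (Matrix.vecMulVec x x) := by
  rw [matInner_comm, matInner_vecMulVec]

theorem matInner_add_left (M N B : Matrix (Fin p) (Fin p) ℝ) :
    matInner (M + N) B = matInner M B + matInner N B := by
  simp [matInner, add_mul, Finset.sum_add_distrib]

theorem matInner_add_right (M B C : Matrix (Fin p) (Fin p) ℝ) :
    matInner M (B + C) = matInner M B + matInner M C := by
  simp [matInner, mul_add, Finset.sum_add_distrib]

theorem matInner_smul_right (c : ℝ) (M B : Matrix (Fin p) (Fin p) ℝ) :
    matInner M (c • B) = c * matInner M B := by
  simp only [matInner, Finset.mul_sum, Matrix.smul_apply, smul_eq_mul]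
  exact Finset.sum_congr rfl fun i _ ↦ Finset.sum_congr rfl fun j _ ↦ by ring

theorem matInner_sum_left {ι : Type*} (s : Finset ι) (M : ι → Matrix (Fin p) (Fin p) ℝ)
    (B : Matrix (Fin p) (Fin p) ℝ) : matInner (∑ t ∈ s, M t) B = ∑ t ∈ s, matInner (M t) B := by
  classical
  induction s using Finset.induction_on with
  | empty => simp [matInner]
  | insert a s ha ih => rw [Finset.sum_insert ha, Finset.sum_insert ha, matInner_add_left, ih]

theorem mul_diagonal_mul_transpose_apply (V : Matrix (Fin p) (Fin m) ℝ) (π : Fin m → ℝ)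
    (a b : Fin p) :
    (V * Matrix.diagonal π * Vᵀ) a b = ∑ j, π j * (V a j * V b j) := by
  rw [Matrix.mul_apply]
  exact Finset.sum_congr rfl fun j _ ↦ by
    rw [Matrix.mul_diagonal, Matrix.transpose_apply]; ring

theorem matInner_mul_diagonal_mul_transpose (V : Matrix (Fin p) (Fin m) ℝ) (π : Fin m → ℝ)
    (B : Matrix (Fin p) (Fin p) ℝ) :
    matInner (V * Matrix.diagonal π * Vᵀ) B = ∑ j, π j * quad B (fun i ↦ V i j) := by
  have h : V * Matrix.diagonal π * Vᵀ
      = ∑ j, π j • Matrix.vecMulVec (fun i ↦ V i j) (fun i ↦ V i j) := by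
    ext a b
    rw [mul_diagonal_mul_transpose_apply, Matrix.sum_apply]
    simp [Matrix.vecMulVec_apply]
  rw [h, matInner_sum_left]
  exact Finset.sum_congr rfl fun j _ ↦ by
    rw [matInner_comm, matInner_smul_right, matInner_comm, matInner_vecMulVec]

theorem quad_mul_diagonal_mul_transpose (V : Matrix (Fin p) (Fin m) ℝ) (π : Fin m → ℝ)
    (β : Fin p → ℝ) :
    quad (V * Matrix.diagonal π * Vᵀ) β = ∑ j, π j * ((fun i ↦ V i j) ⬝ᵥ β) ^ 2 := by
  simp only [quad_eq_matInner _ β, matInner_mul_diagonal_mul_transpose, quad_vecMulVec]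

theorem quad_nonneg_of_posSemidef {A : Matrix (Fin p) (Fin p) ℝ} (hA : A.PosSemidef)
    (x : Fin p → ℝ) : 0 ≤ quad A x := by
  simpa [quad] using hA.dotProduct_mulVec_nonneg x

theorem posSemidef_of_quad_nonneg {A : Matrix (Fin p) (Fin p) ℝ} (hs : A.IsSymm)
    (h : ∀ x, 0 ≤ quad A x) : A.PosSemidef :=
  .of_dotProduct_mulVec_nonneg (by simpa [Matrix.IsHermitian, Matrix.IsSymm] using hs)
    (by simpa [quad] using h)

open scoped MatrixOrder Matrix.Norms.L2Operator in
/-- A positive semidefinite matrix supported on `T × T` is a sum of rank-one matrices supported on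
`T × T`. -/
theorem exists_matInner_eq_sum_quad {A : Matrix (Fin p) (Fin p) ℝ} (hA : A.PosSemidef)
    {T : Finset (Fin p)} (hT : ∀ i, i ∉ T → A i i = 0) :
    ∃ N : Fin p → Fin p → ℝ, (∀ k i, i ∉ T → N k i = 0) ∧
      ∀ B, matInner A B = ∑ k, quad B (N k) := by
  obtain ⟨N, hN⟩ := CStarAlgebra.nonneg_iff_eq_star_mul_self.mp hA.nonneg
  have hentry : ∀ a b, A a b = ∑ k, N k a * N k b := fun a b ↦ by
    simp [hN, Matrix.mul_apply, Matrix.star_apply]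
  refine ⟨N, fun k i hi ↦ ?_, fun B ↦ ?_⟩
  -- A diagonal entry of `A` is the sum of squares of a column of `N`, so a zero entry kills that
  -- column.
  · have h := hT i hi
    rw [hentry, Finset.sum_eq_zero_iff_of_nonneg fun _ _ ↦ mul_self_nonneg _] at h
    exact mul_self_eq_zero.1 (h k (Finset.mem_univ k))
  · have h : A = ∑ k, Matrix.vecMulVec (N k) (N k) := by
      ext a b
      rw [hentry, Matrix.sum_apply]
      simp [Matrix.vecMulVec_apply]
    rw [h, matInner_sum_left]
    exact Finset.sum_congr rfl fun k _ ↦ matInner_vecMulVec _ _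

theorem quad_eq_zero_of_supp {A : Matrix (Fin p) (Fin p) ℝ} {T : Finset (Fin p)}
    (hT : ∀ i j, (i ∉ T ∨ j ∉ T) → A i j = 0) {β : Fin p → ℝ} (hβ : ∀ i ∈ T, β i = 0) :
    quad A β = 0 := by
  rw [quad_eq_sum]
  refine Finset.sum_eq_zero fun i _ ↦ Finset.sum_eq_zero fun j _ ↦ ?_
  by_cases hi : i ∈ T
  · simp [hβ i hi]
  · simp [hT i j (.inl hi)]

end Algebra

/-! ### The dual constraints, weak duality and the cone of decompositions -/

section Duality

variable {p m : ℕ}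

/-- `B` satisfies the linear conic constraints dual to `IsDecomposition`: on vectors supported on
`T ∈ Fam` it dominates `ββᵀ / s T`, and on the columns of `V` it dominates `ββᵀ`. -/
structure Dominates (Fam : Finset (Finset (Fin p))) (s : Finset (Fin p) → ℝ)
    (V : Matrix (Fin p) (Fin m) ℝ) (β : Fin p → ℝ) (B : Matrix (Fin p) (Fin p) ℝ) : Prop where
  symm : B.IsSymm
  le_quad : ∀ T ∈ Fam, ∀ x : Fin p → ℝ, (∀ i, i ∉ T → x i = 0) → (x ⬝ᵥ β) ^ 2 / s T ≤ quad B x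
  le_quad_col : ∀ j, ((fun i ↦ V i j) ⬝ᵥ β) ^ 2 ≤ quad B (fun i ↦ V i j)

/-- Weak duality. -/
theorem Dominates.le_matInner {Fam : Finset (Finset (Fin p))} {s : Finset (Fin p) → ℝ}
    {V : Matrix (Fin p) (Fin m) ℝ} {β : Fin p → ℝ} {B Q R : Matrix (Fin p) (Fin p) ℝ}
    {A : Finset (Fin p) → Matrix (Fin p) (Fin p) ℝ} {π : Fin m → ℝ}
    (hB : Dominates Fam s V β B) (hD : IsDecomposition Fam Q V A R π) :
    quad R β + ∑ T ∈ Fam, quad (A T) β / s T ≤ matInner Q B := by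
  rw [← hD.sum_eq, matInner_add_left, matInner_sum_left, add_comm]
  refine add_le_add (Finset.sum_le_sum fun T hT ↦ ?_) ?_
  · obtain ⟨N, hN, hsum⟩ := exists_matInner_eq_sum_quad (hD.psd T hT)
      fun i hi ↦ hD.supp T hT i i (.inl hi)
    rw [quad_eq_matInner, hsum, hsum, Finset.sum_div]
    refine Finset.sum_le_sum fun k _ ↦ ?_
    rw [quad_vecMulVec]
    exact hB.le_quad T hT _ (hN k)
  · rw [hD.rem_eq, quad_mul_diagonal_mul_transpose, matInner_mul_diagonal_mul_transpose]
    exact Finset.sum_le_sum fun j _ ↦ mul_le_mul_of_nonneg_left (hB.le_quad_col j) (hD.nonneg j)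

/-- The cone of pairs `(A, π)` as in `IsDecomposition`, together with a nonnegative slack. -/
noncomputable def decompositionCone (m : ℕ) (Fam : Finset (Finset (Fin p))) :
    ProperCone ℝ ((Finset (Fin p) → Fin p → Fin p → ℝ) × (Fin m → ℝ) × ℝ) where
  carrier := {x | (∀ T, (Matrix.of (x.1 T)).PosSemidef) ∧
    -- Blocks with `T ∉ Fam` are set to zero because `decompositionMap` does not see them and must
    -- have trivial kernel on the cone. The slack turns "value at least `v`" into an equation.
    (∀ T i j, (T ∉ Fam ∨ i ∉ T ∨ j ∉ T) → x.1 T i j = 0) ∧ (∀ j, 0 ≤ x.2.1 j) ∧ 0 ≤ x.2.2}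
  add_mem' {x y} hx hy := ⟨fun T ↦ (hx.1 T).add (hy.1 T),
    fun T i j h ↦ by simp [hx.2.1 T i j h, hy.2.1 T i j h],
    fun j ↦ add_nonneg (hx.2.2.1 j) (hy.2.2.1 j), add_nonneg hx.2.2.2 hy.2.2.2⟩
  zero_mem' := ⟨fun T ↦ .zero, fun _ _ _ _ ↦ rfl, fun _ ↦ le_rfl, le_rfl⟩
  smul_mem' c x hx := ⟨fun T ↦ (hx.1 T).smul (a := (c : ℝ)) c.2,
    fun T i j h ↦ by simp [hx.2.1 T i j h],
    fun j ↦ mul_nonneg c.2 (hx.2.2.1 j), mul_nonneg c.2 hx.2.2.2⟩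
  isClosed' := by
    have hpsd : IsClosed {M : Fin p → Fin p → ℝ | (Matrix.of M).PosSemidef} := by
      have : {M : Fin p → Fin p → ℝ | (Matrix.of M).PosSemidef}
          = {M | ∀ i j, M i j = M j i} ∩ {M | ∀ x : Fin p → ℝ, 0 ≤ ∑ i, ∑ j, x i * x j * M i j} := by
        ext M
        constructor
        · intro h
          refine ⟨fun i j ↦ ?_, fun x ↦ ?_⟩
          · simpa using h.1.apply j i
          · simpa [quad_eq_sum] using quad_nonneg_of_posSemidef h x
        · rintro ⟨h, h'⟩
          refine posSemidef_of_quad_nonneg (Matrix.IsSymm.ext fun i j ↦ h j i) fun x ↦ ?_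
          rw [quad_eq_sum]
          exact h' x
      rw [this]
      simp only [Set.ofPred_forall]
      exact (isClosed_iInter fun i ↦ isClosed_iInter fun j ↦
          isClosed_eq (by fun_prop) (by fun_prop)).inter
        (isClosed_iInter fun x ↦ isClosed_le (by fun_prop) (by fun_prop))
    simp only [Set.ofPred_and, Set.ofPred_forall]
    refine (isClosed_iInter fun T ↦ hpsd.preimage (by fun_prop)).inter
      (.inter (isClosed_iInter fun T ↦ isClosed_iInter fun i ↦ isClosed_iInter fun j ↦
        isClosed_iInter fun _ ↦ isClosed_eq (by fun_prop) (by fun_prop))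
        (.inter (isClosed_iInter fun j ↦ isClosed_le (by fun_prop) (by fun_prop))
          (isClosed_le (by fun_prop) (by fun_prop))))

/-- The map `(A, π, t) ↦ (∑ A_T + V diag(π) Vᵀ, value - t)`, where `value` is the value of the
decomposition `(A, π)` with denominators `s`. -/
noncomputable def decompositionMap (Fam : Finset (Finset (Fin p))) (s : Finset (Fin p) → ℝ)
    (V : Matrix (Fin p) (Fin m) ℝ) (β : Fin p → ℝ) :
    ((Finset (Fin p) → Fin p → Fin p → ℝ) × (Fin m → ℝ) × ℝ) →L[ℝ] (Fin p → Fin p → ℝ) × ℝ :=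
  LinearMap.toContinuousLinearMap
    { toFun := fun x ↦ (fun a b ↦ ∑ T ∈ Fam, x.1 T a b + ∑ j, x.2.1 j * (V a j * V b j),
        ∑ j, x.2.1 j * ((fun i ↦ V i j) ⬝ᵥ β) ^ 2
          + ∑ T ∈ Fam, quad (Matrix.of (x.1 T)) β / s T - x.2.2)
      map_add' := fun x y ↦ by
        refine Prod.ext (funext fun a ↦ funext fun b ↦ ?_) ?_
        · simp only [Prod.fst_add, Prod.snd_add, Pi.add_apply, add_mul, Finset.sum_add_distrib]
          ring
        · simp only [Prod.fst_add, Prod.snd_add, Pi.add_apply, ← Matrix.of_add_of, quad_add,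
            add_mul, add_div, Finset.sum_add_distrib]
          ring
      map_smul' := fun c x ↦ by
        refine Prod.ext (funext fun a ↦ funext fun b ↦ ?_) ?_
        · simp only [Prod.smul_fst, Prod.smul_snd, Pi.smul_apply, smul_eq_mul, mul_assoc,
            ← Finset.mul_sum, RingHom.id_apply, mul_add]
        · simp only [Prod.smul_fst, Prod.smul_snd, Pi.smul_apply, smul_eq_mul,
            ← Matrix.smul_of, quad_smul, mul_assoc, mul_div_assoc, ← Finset.mul_sum,
            RingHom.id_apply, mul_add, mul_sub] }

end Duality

/-! ### Strong duality -/

section StrongDuality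

variable {p m : ℕ}

/-- All diagonal contributions are nonnegative, so each vanishes. A positive semidefinite matrix of
trace zero is zero, and a nonzero entry of a column of `V` forces its weight to vanish. The slack is
then zero as well. -/
theorem eq_zero_of_decompositionMap_eq_zero {Fam : Finset (Finset (Fin p))}
    {s : Finset (Fin p) → ℝ} {V : Matrix (Fin p) (Fin m) ℝ} {β : Fin p → ℝ}
    (hV : ∀ j, (fun i ↦ V i j) ≠ 0)
    {x : (Finset (Fin p) → Fin p → Fin p → ℝ) × (Fin m → ℝ) × ℝ}
    (hx : x ∈ decompositionCone m Fam) (h0 : decompositionMap Fam s V β x = 0) : x = 0 := by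
  obtain ⟨hpsd, hsupp, hπ, -⟩ := hx
  have h1 : ∀ a, ∑ T ∈ Fam, x.1 T a a + ∑ j, x.2.1 j * (V a j * V a j) = 0 := fun a ↦
    congrFun (congrFun (congrArg Prod.fst h0) a) a
  have h2 : ∑ j, x.2.1 j * ((fun i ↦ V i j) ⬝ᵥ β) ^ 2
      + ∑ T ∈ Fam, quad (Matrix.of (x.1 T)) β / s T - x.2.2 = 0 := congrArg Prod.snd h0
  have hdiag : ∀ T a, 0 ≤ x.1 T a a := fun T a ↦ (hpsd T).diag_nonneg
  have hcol : ∀ a j, 0 ≤ x.2.1 j * (V a j * V a j) := fun a j ↦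
    mul_nonneg (hπ j) (mul_self_nonneg _)
  have h3 := fun a ↦ (add_eq_zero_iff_of_nonneg (Finset.sum_nonneg fun T _ ↦ hdiag T a)
    (Finset.sum_nonneg fun j _ ↦ hcol a j)).1 (h1 a)
  have hA : x.1 = 0 := by
    funext T
    by_cases hT : T ∈ Fam
    · refine Matrix.of.injective ((hpsd T).trace_eq_zero_iff.1 ?_)
      exact Finset.sum_eq_zero fun a _ ↦
        (Finset.sum_eq_zero_iff_of_nonneg fun T _ ↦ hdiag T a).1 (h3 a).1 T hT
    · funext i j
      exact hsupp T i j (.inl hT)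
  have hπ0 : x.2.1 = 0 := by
    funext j
    obtain ⟨a, ha⟩ := Function.ne_iff.1 (hV j)
    have := (Finset.sum_eq_zero_iff_of_nonneg fun j _ ↦ hcol a j).1 (h3 a).2 j (Finset.mem_univ j)
    exact (mul_eq_zero.1 this).resolve_right (mul_self_ne_zero.2 ha)
  have ht : x.2.2 = 0 := by
    simpa [hA, hπ0, quad, eq_comm] using h2
  exact Prod.ext hA (Prod.ext hπ0 ht)

theorem strongDual_apply_eq (g : StrongDual ℝ ((Fin p → Fin p → ℝ) × ℝ))
    (M : Fin p → Fin p → ℝ) (r : ℝ) :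
    g (M, r) = ∑ a, ∑ b, M a b * g (Pi.single a (Pi.single b 1), 0) + r * g (0, 1) := by
  have hM : ((M, r) : (Fin p → Fin p → ℝ) × ℝ)
      = ∑ a, ∑ b, M a b • (Pi.single a (Pi.single b 1), 0) + r • (0, 1) := by
    refine Prod.ext ?_ ?_
    · funext i j
      simp [Prod.fst_sum, Finset.sum_apply, Pi.single_apply]
    · simp [Prod.snd_sum]
  conv_lhs => rw [hM]
  simp only [map_add, map_sum, map_smul, smul_eq_mul]

/-- Strong duality, with attainment on the side of the decompositions. -/
theorem exists_isDecomposition_le {Fam : Finset (Finset (Fin p))}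
    {s : Finset (Fin p) → ℝ} {V : Matrix (Fin p) (Fin m) ℝ} {β : Fin p → ℝ}
    (hV : ∀ j, (fun i ↦ V i j) ≠ 0) {Q : Matrix (Fin p) (Fin p) ℝ} (hQ : Q.IsSymm)
    {B₀ : Matrix (Fin p) (Fin p) ℝ} (hB₀ : Dominates Fam s V β B₀) {v : ℝ}
    (hv : ∀ B, Dominates Fam s V β B → v ≤ matInner Q B) :
    ∃ A R π, IsDecomposition Fam Q V A R π ∧ v ≤ quad R β + ∑ T ∈ Fam, quad (A T) β / s T := by
  suffices h : ∀ g : StrongDual ℝ ((Fin p → Fin p → ℝ) × ℝ),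
      (∀ x ∈ decompositionCone m Fam, 0 ≤ g (decompositionMap Fam s V β x)) → 0 ≤ g (Q, v) by
    obtain ⟨x, ⟨hpsd, hsupp, hπ, ht⟩, hx⟩ :=
      (decompositionCone m Fam).exists_apply_eq_of_forall_dual (decompositionMap Fam s V β)
        (fun x hx h0 ↦ eq_zero_of_decompositionMap_eq_zero hV hx h0) (Q, v) h
    have h1 : ∀ a b, ∑ T ∈ Fam, x.1 T a b + ∑ j, x.2.1 j * (V a j * V b j) = Q a b := fun a b ↦
      congrFun (congrFun (congrArg Prod.fst hx) a) b
    have h2 : ∑ j, x.2.1 j * ((fun i ↦ V i j) ⬝ᵥ β) ^ 2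
        + ∑ T ∈ Fam, quad (Matrix.of (x.1 T)) β / s T - x.2.2 = v := congrArg Prod.snd hx
    refine ⟨fun T ↦ Matrix.of (x.1 T), V * Matrix.diagonal x.2.1 * Vᵀ, x.2.1,
      ⟨?_, fun T _ i j h ↦ hsupp T i j (.inr h), fun T _ ↦ hpsd T, rfl, hπ⟩, ?_⟩
    · ext a b
      rw [Matrix.add_apply, Matrix.sum_apply, mul_diagonal_mul_transpose_apply, ← h1]
      rfl
    · rw [quad_mul_diagonal_mul_transpose]
      have : 0 ≤ x.2.2 := ht
      linarith
  intro g hg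
  -- On symmetric matrices `g` is `(M, r) ↦ ⟨M, B⟩ - r σ`. Testing it on the slack, on rank-one
  -- blocks and on single weights shows that `σ ≥ 0` and that `B` satisfies the dual constraints
  -- scaled by `σ`.
  set C : Matrix (Fin p) (Fin p) ℝ := fun a b ↦ g (Pi.single a (Pi.single b 1), 0) with hC
  set σ : ℝ := -g (0, 1) with hσ
  set B : Matrix (Fin p) (Fin p) ℝ := (2⁻¹ : ℝ) • (C + Cᵀ) with hB
  have hBsymm : B.IsSymm := by
    rw [Matrix.IsSymm, hB, Matrix.transpose_smul, Matrix.transpose_add,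
      Matrix.transpose_transpose, add_comm]
  have hgB : ∀ (M : Fin p → Fin p → ℝ) (r : ℝ), (∀ a b, M a b = M b a) →
      g (M, r) = matInner (Matrix.of M) B - r * σ := by
    intro M r hM
    have ht : matInner (Matrix.of M) Cᵀ = matInner (Matrix.of M) C := by
      rw [matInner, Finset.sum_comm]
      exact Finset.sum_congr rfl fun i _ ↦ Finset.sum_congr rfl fun j _ ↦ by
        rw [Matrix.transpose_apply, Matrix.of_apply, hM, Matrix.of_apply]
    rw [strongDual_apply_eq, hB, matInner_smul_right, matInner_add_right, ht, hσ]
    change matInner (Matrix.of M) C + _ = _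
    ring
  have hσ0 : 0 ≤ σ := by
    have h := hg (0, 0, 1) ⟨fun _ ↦ .zero, fun _ _ _ _ ↦ rfl, fun _ ↦ le_rfl, zero_le_one⟩
    have he : decompositionMap Fam s V β (0, 0, 1) = (0, -1) := by
      refine Prod.ext ?_ ?_
      · funext a b
        simp [decompositionMap]
      · simp [decompositionMap, quad]
    rw [he, hgB 0 _ fun _ _ ↦ rfl] at h
    simpa [matInner] using h
  have hBT : ∀ T ∈ Fam, ∀ x : Fin p → ℝ, (∀ i, i ∉ T → x i = 0) →
      (x ⬝ᵥ β) ^ 2 / s T * σ ≤ quad B x := by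
    intro T hT x hx
    have h := hg (Pi.single T (fun a b ↦ x a * x b), 0, 0) ⟨fun S ↦ ?_, fun S i j h ↦ ?_,
      fun _ ↦ le_rfl, le_rfl⟩
    · have he : decompositionMap Fam s V β (Pi.single T (fun a b ↦ x a * x b), 0, 0)
          = (fun a b ↦ x a * x b, (x ⬝ᵥ β) ^ 2 / s T) := by
        refine Prod.ext ?_ ?_
        · funext a b
          simp [decompositionMap, Pi.single_apply, ite_apply, hT]
        · have : ∀ S ∈ Fam, quad (Matrix.of
              ((Pi.single T (fun a b ↦ x a * x b) : Finset (Fin p) → Fin p → Fin p → ℝ) S)) β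
                / s S = if S = T then (x ⬝ᵥ β) ^ 2 / s T else 0 := by
            intro S _
            split_ifs with hS
            · subst hS
              rw [Pi.single_eq_same, dotProduct_comm, ← quad_vecMulVec]
              rfl
            · rw [Pi.single_eq_of_ne hS]
              simp [quad]
          simp [decompositionMap, Finset.sum_congr rfl this, hT]
      rw [he, hgB _ _ fun a b ↦ mul_comm _ _, ← Matrix.vecMulVec, matInner_vecMulVec] at h
      linarith
    · dsimp only
      rcases eq_or_ne S T with rfl | hS
      · rw [Pi.single_eq_same]
        exact Matrix.posSemidef_vecMulVec_self_star x
      · rw [Pi.single_eq_of_ne hS]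
        exact Matrix.PosSemidef.zero
    · rcases eq_or_ne S T with rfl | hS
      · rcases h with h | h | h
        · exact absurd hT h
        · simp [hx i h]
        · simp [hx j h]
      · simp [Pi.single_eq_of_ne hS]
  have hBV : ∀ j, ((fun i ↦ V i j) ⬝ᵥ β) ^ 2 * σ ≤ quad B (fun i ↦ V i j) := by
    intro j
    have h := hg (0, Pi.single j 1, 0) ⟨fun _ ↦ .zero, fun _ _ _ _ ↦ rfl,
      fun i ↦ by simp only [Pi.single_apply]; split_ifs <;> norm_num, le_rfl⟩
    have he : decompositionMap Fam s V β (0, Pi.single j 1, 0)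
        = (fun a b ↦ V a j * V b j, ((fun i ↦ V i j) ⬝ᵥ β) ^ 2) := by
      refine Prod.ext ?_ ?_
      · funext a b
        simp [decompositionMap, Pi.single_apply]
      · simp [decompositionMap, Pi.single_apply, quad]
    rw [he, hgB _ _ fun a b ↦ mul_comm _ _, ← Matrix.vecMulVec, matInner_vecMulVec] at h
    linarith
  -- `(B₀ + t B) / (1 + t σ)` is dual feasible for every `t ≥ 0`, whether `σ` is positive or `B` is
  -- only a recession direction. Large `t` then gives `v σ ≤ ⟨Q, B⟩`.
  have hray : ∀ t : ℝ, 0 ≤ t → v * (1 + t * σ) ≤ matInner Q B₀ + t * matInner Q B := by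
    intro t ht
    have hpos : 0 < 1 + t * σ := by positivity
    have key : ∀ x : ℝ, ∀ y : Fin p → ℝ, x ≤ quad B₀ y → x * σ ≤ quad B y →
        x ≤ quad ((1 + t * σ)⁻¹ • (B₀ + t • B)) y := by
      intro x y h h'
      rw [quad_smul, quad_add, quad_smul, inv_mul_eq_div, le_div_iff₀ hpos]
      nlinarith [mul_le_mul_of_nonneg_left h' ht]
    have h := hv ((1 + t * σ)⁻¹ • (B₀ + t • B))
      ⟨(hB₀.symm.add (hBsymm.smul t)).smul _,
        fun T hT x hx ↦ key _ _ (hB₀.le_quad T hT x hx) (hBT T hT x hx),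
        fun j ↦ key _ _ (hB₀.le_quad_col j) (hBV j)⟩
    rwa [matInner_smul_right, matInner_add_right, matInner_smul_right, inv_mul_eq_div,
      le_div_iff₀ hpos] at h
  refine le_of_le_of_eq ?_ (hgB Q v fun a b ↦ hQ.apply b a).symm
  change 0 ≤ matInner Q B - v * σ
  by_contra! hneg
  obtain ⟨t, ht⟩ := exists_nat_gt ((matInner Q B₀ - v) / (v * σ - matInner Q B))
  rw [div_lt_iff₀ (by linarith)] at ht
  nlinarith [hray t t.cast_nonneg]

end StrongDuality

/-! ### The SDP constraints as dual constraints -/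

section Reduction

variable {n p m : ℕ}

/-- Half of a Schur complement: raising `w` to `s` keeps the quadratic nonnegative, and `-q / s`
minimizes the result. For `s = 0` the quotient is `0` and `a = 0` suffices. -/
theorem sq_div_le_of_forall_nonneg {w s q r : ℝ} (hw : 0 ≤ w) (hws : w ≤ s)
    (h : ∀ a : ℝ, 0 ≤ w * a ^ 2 + 2 * a * q + r) : q ^ 2 / s ≤ r := by
  rcases (hw.trans hws).eq_or_lt with rfl | hs
  · simpa using h 0
  · have h1 := h (-q / s)
    have h2 : w * (-q / s) ^ 2 ≤ s * (-q / s) ^ 2 := mul_le_mul_of_nonneg_right hws (sq_nonneg _)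
    have h3 : s * (-q / s) ^ 2 + 2 * (-q / s) * q = -(q ^ 2 / s) := by
      field_simp
      ring
    linarith

theorem nonneg_of_sq_div_le {w q r : ℝ} (hw : 0 ≤ w) (hq : w = 0 → q = 0) (h : q ^ 2 / w ≤ r)
    (a : ℝ) : 0 ≤ w * a ^ 2 + 2 * a * q + r := by
  rcases hw.eq_or_lt with rfl | hs
  · simpa [hq rfl] using h
  · have h1 : w * a ^ 2 + 2 * a * q + q ^ 2 / w = w * (a + q / w) ^ 2 := by
      field_simp
      ring
    have h2 : 0 ≤ w * (a + q / w) ^ 2 := by positivity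
    linarith

theorem posSemidef_fin_two_iff {a b c : ℝ} :
    (!![a, b; b, c] : Matrix (Fin 2) (Fin 2) ℝ).PosSemidef ↔
      ∀ t x : ℝ, 0 ≤ a * t ^ 2 + 2 * t * (x * b) + x ^ 2 * c := by
  constructor
  · intro h t x
    have := quad_nonneg_of_posSemidef h ![t, x]
    rw [quad_eq_sum] at this
    simp [Fin.sum_univ_succ] at this
    linarith
  · intro h
    refine posSemidef_of_quad_nonneg (Matrix.IsSymm.ext fun i j ↦ ?_) fun x ↦ ?_
    · fin_cases i <;> fin_cases j <;> rfl
    · have := h (x 0) (x 1)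
      rw [quad_eq_sum]
      simp [Fin.sum_univ_succ]
      linarith

theorem posSemidef_fin_three_iff {w b c d e f : ℝ} :
    (!![w, b, c; b, d, e; c, e, f] : Matrix (Fin 3) (Fin 3) ℝ).PosSemidef ↔
      ∀ t x y : ℝ, 0 ≤ w * t ^ 2 + 2 * t * (x * b + y * c)
        + (x ^ 2 * d + 2 * (x * y * e) + y ^ 2 * f) := by
  constructor
  · intro h t x y
    have := quad_nonneg_of_posSemidef h ![t, x, y]
    rw [quad_eq_sum] at this
    simp [Fin.sum_univ_succ] at this
    linarith
  · intro h
    refine posSemidef_of_quad_nonneg (Matrix.IsSymm.ext fun i j ↦ ?_) fun x ↦ ?_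
    · fin_cases i <;> fin_cases j <;> rfl
    · have := h (x 0) (x 1) (x 2)
      rw [quad_eq_sum]
      simp [Fin.sum_univ_succ]
      linarith

theorem dotProduct_eq_sum_of_supp {T : Finset (Fin p)} {x : Fin p → ℝ} (hx : ∀ i, i ∉ T → x i = 0)
    (β : Fin p → ℝ) : x ⬝ᵥ β = ∑ i ∈ T, x i * β i :=
  (Finset.sum_subset T.subset_univ fun i _ hi ↦ by simp [hx i hi]).symm

theorem quad_eq_sum_of_supp {T : Finset (Fin p)} {x : Fin p → ℝ} (hx : ∀ i, i ∉ T → x i = 0)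
    (B : Matrix (Fin p) (Fin p) ℝ) : quad B x = ∑ i ∈ T, ∑ j ∈ T, x i * x j * B i j := by
  rw [quad_eq_sum]
  refine (Finset.sum_subset T.subset_univ fun i _ hi ↦ by simp [hx i hi]).symm.trans ?_
  exact Finset.sum_congr rfl fun i _ ↦
    (Finset.sum_subset T.subset_univ fun j _ hj ↦ by simp [hx j hj]).symm

theorem InnerFeasible.eq_zero_of_eq_zero {V : Matrix (Fin p) (Fin m) ℝ} {β z : Fin p → ℝ}
    {w : Fin p → Fin p → ℝ} {B : Matrix (Fin p) (Fin p) ℝ} (h : InnerFeasible V β z w B)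
    {i : Fin p} (hi : z i = 0) : β i = 0 := by
  have h2 := posSemidef_fin_two_iff.1 (h.psd_two i)
  by_contra hβ
  -- With `z i = 0` the form is affine in its first argument, which is chosen here to make the value
  -- `-1`.
  have h3 := h2 (-(B i i + 1) / (2 * β i)) 1
  have h4 : 2 * (-(B i i + 1) / (2 * β i)) * (1 * β i) = -(B i i + 1) := by
    field_simp
  rw [h4, hi] at h3
  linarith

theorem InnerFeasible.dominates {V : Matrix (Fin p) (Fin m) ℝ} {β z : Fin p → ℝ}
    {w : Fin p → Fin p → ℝ} {B : Matrix (Fin p) (Fin p) ℝ} (hz : ∀ i, z i ∈ Set.Icc (0 : ℝ) 1)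
    (h : InnerFeasible V β z w B) :
    Dominates (pairs p) (fun T ↦ min 1 (∑ i ∈ T, z i)) V β B := by
  have hpair : ∀ i j, i < j → ∀ x : Fin p → ℝ, (∀ a, a ∉ ({i, j} : Finset (Fin p)) → x a = 0) →
      (x ⬝ᵥ β) ^ 2 / min 1 (∑ a ∈ {i, j}, z a) ≤ quad B x := by
    intro i j hij x hx
    rw [dotProduct_eq_sum_of_supp hx, quad_eq_sum_of_supp hx]
    simp only [Finset.sum_pair hij.ne]
    refine sq_div_le_of_forall_nonneg (h.w_nonneg i j hij) (h.w_le i j hij) fun t ↦ ?_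
    have := posSemidef_fin_three_iff.1 (h.psd_three i j hij) t (x i) (x j)
    rw [h.symm.apply i j]
    linarith
  refine ⟨h.symm, fun T hT x hx ↦ ?_, fun j ↦ ?_⟩
  · have hcard : T.card ≤ 2 := by simpa [pairs] using hT
    interval_cases hc : T.card
    · obtain rfl := Finset.card_eq_zero.1 hc
      simp [dotProduct_eq_sum_of_supp hx, quad_eq_sum_of_supp hx]
    · obtain ⟨i, rfl⟩ := Finset.card_eq_one.1 hc
      rw [dotProduct_eq_sum_of_supp hx, quad_eq_sum_of_supp hx]
      simp only [Finset.sum_singleton]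
      refine sq_div_le_of_forall_nonneg (hz i).1 (le_min (hz i).2 le_rfl) fun t ↦ ?_
      have := posSemidef_fin_two_iff.1 (h.psd_two i) t (x i)
      linarith
    · obtain ⟨i, j, hij, rfl⟩ := Finset.card_eq_two.1 hc
      rcases hij.lt_or_gt with hij | hij
      · exact hpair i j hij x hx
      · rw [Finset.pair_comm] at hx ⊢
        exact hpair j i hij x hx
  · have := h.rank_one j
    rw [quad_sub, quad_vecMulVec] at this
    linarith

/-- The upper bound for `w` is the least restrictive choice. Where the denominator is `0`, division
by zero makes `Dominates` say only `0 ≤ quad B x`; `hβ` supplies the vanishing of the off-diagonal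
entries. -/
theorem Dominates.innerFeasible {V : Matrix (Fin p) (Fin m) ℝ} {β z : Fin p → ℝ}
    {B : Matrix (Fin p) (Fin p) ℝ} (hz : ∀ i, z i ∈ Set.Icc (0 : ℝ) 1)
    (hβ : ∀ i, z i = 0 → β i = 0)
    (h : Dominates (pairs p) (fun T ↦ min 1 (∑ i ∈ T, z i)) V β B) :
    InnerFeasible V β z (fun i j ↦ min 1 (z i + z j)) B := by
  refine ⟨h.symm, fun i ↦ posSemidef_fin_two_iff.2 fun t b ↦ ?_,
    fun i j _ ↦ le_min zero_le_one (add_nonneg (hz i).1 (hz j).1), fun i j _ ↦ le_rfl,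
    fun i j hij ↦ posSemidef_fin_three_iff.2 fun t b c ↦ ?_, fun j ↦ ?_⟩
  · have hx : ∀ a, a ∉ ({i} : Finset (Fin p)) → (Pi.single i b : Fin p → ℝ) a = 0 := fun a ha ↦
      Pi.single_eq_of_ne (by simpa using ha) _
    have h1 := h.le_quad {i} (by simp [pairs]) _ hx
    rw [dotProduct_eq_sum_of_supp hx, quad_eq_sum_of_supp hx] at h1
    simp only [Finset.sum_singleton, Pi.single_eq_same, min_eq_right (hz i).2] at h1
    have := nonneg_of_sq_div_le (hz i).1 (fun h0 ↦ by simp [hβ i h0]) h1 t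
    linarith
  · set x : Fin p → ℝ := fun a ↦ if a = i then b else if a = j then c else 0 with hxdef
    have hxi : x i = b := by simp [hxdef]
    have hxj : x j = c := by simp [hxdef, hij.ne']
    have hx : ∀ a, a ∉ ({i, j} : Finset (Fin p)) → x a = 0 := fun a ha ↦ by
      simp only [Finset.mem_insert, Finset.mem_singleton, not_or] at ha
      simp [hxdef, ha.1, ha.2]
    have h1 := h.le_quad {i, j} (by simp [pairs, Finset.card_le_two]) _ hx
    rw [dotProduct_eq_sum_of_supp hx, quad_eq_sum_of_supp hx] at h1
    simp only [Finset.sum_pair hij.ne, hxi, hxj, h.symm.apply i j] at h1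
    have := nonneg_of_sq_div_le (le_min zero_le_one (add_nonneg (hz i).1 (hz j).1))
      (fun h0 ↦ ?_) h1 t
    · linarith
    · have h2 : z i + z j = 0 := by
        rcases min_choice 1 (z i + z j) with h3 | h3 <;> linarith
      rw [hβ i (by linarith [(hz i).1, (hz j).1]), hβ j (by linarith [(hz i).1, (hz j).1])]
      ring
  · have := h.le_quad_col j
    rw [quad_sub, quad_vecMulVec]
    linarith

/-- A multiple of `ββᵀ` works once its coefficient is at least `1` and at least the inverse of each
denominator. -/
theorem exists_dominates (Fam : Finset (Finset (Fin p))) (V : Matrix (Fin p) (Fin m) ℝ)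
    (β : Fin p → ℝ) {z : Fin p → ℝ} (hz : ∀ i, z i ∈ Set.Icc (0 : ℝ) 1) :
    ∃ B, Dominates Fam (fun T ↦ min 1 (∑ i ∈ T, z i)) V β B := by
  have hs : ∀ T : Finset (Fin p), 0 ≤ min 1 (∑ i ∈ T, z i) := fun T ↦
    le_min zero_le_one (Finset.sum_nonneg fun i _ ↦ (hz i).1)
  refine ⟨(1 + ∑ T ∈ Fam, (min 1 (∑ i ∈ T, z i))⁻¹) • Matrix.vecMulVec β β,
    ⟨Matrix.IsSymm.smul (Matrix.transpose_vecMulVec _ _) _, fun T hT x hx ↦ ?_, fun j ↦ ?_⟩⟩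
  · rw [quad_smul, quad_vecMulVec, div_eq_mul_inv, mul_comm]
    refine mul_le_mul_of_nonneg_right ?_ (sq_nonneg _)
    have := Finset.single_le_sum (fun S _ ↦ inv_nonneg.2 (hs S)) hT
    linarith
  · rw [quad_smul, quad_vecMulVec]
    refine le_mul_of_one_le_left (sq_nonneg _) ?_
    have := Finset.sum_nonneg fun S (_ : S ∈ Fam) ↦ inv_nonneg.2 (hs S)
    linarith

theorem isSymm_gram (X : Matrix (Fin n) (Fin p) ℝ) (lam : ℝ) : (gram X lam).IsSymm := by
  rw [gram, Matrix.IsSymm]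
  simp

theorem coe_sum_toEReal {ι : Type*} (s : Finset ι) (f : ι → ℝ) :
    ((∑ i ∈ s, f i : ℝ) : EReal) = ∑ i ∈ s, (f i : EReal) := by
  classical
  induction s using Finset.induction_on with
  | empty => simp
  | insert a s ha ih => rw [Finset.sum_insert ha, Finset.sum_insert ha, EReal.coe_add, ih]

/-- The objective of `phi` is real-valued at points where `β` vanishes on the zero set of `z`. -/
theorem coe_quad_add_sum_ratio {Fam : Finset (Finset (Fin p))}
    {Q R : Matrix (Fin p) (Fin p) ℝ} {V : Matrix (Fin p) (Fin m) ℝ}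
    {A : Finset (Fin p) → Matrix (Fin p) (Fin p) ℝ} {π : Fin m → ℝ}
    (hD : IsDecomposition Fam Q V A R π) {β z : Fin p → ℝ}
    (hz : ∀ i, z i ∈ Set.Icc (0 : ℝ) 1) (hβ : ∀ i, z i = 0 → β i = 0) :
    ((quad R β : ℝ) : EReal) + ∑ T ∈ Fam, ratio (quad (A T) β) (min 1 (∑ i ∈ T, z i))
      = ((quad R β + ∑ T ∈ Fam, quad (A T) β / min 1 (∑ i ∈ T, z i) : ℝ) : EReal) := by
  rw [EReal.coe_add, coe_sum_toEReal]
  congr 1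
  refine Finset.sum_congr rfl fun T hT ↦ ?_
  rw [ratio]
  split_ifs with h0 h1
  -- A zero denominator means that `z`, hence `β`, vanishes on `T`, so the value `⊤` never occurs.
  · have hsum : ∑ i ∈ T, z i = 0 := by
      rcases min_choice 1 (∑ i ∈ T, z i) with h3 | h3 <;> linarith
    rw [quad_eq_zero_of_supp (hD.supp T hT) fun i hi ↦ hβ i
      ((Finset.sum_eq_zero_iff_of_nonneg fun i _ ↦ (hz i).1).1 hsum i hi)] at h1
    exact absurd h1 (lt_irrefl 0)
  · simp [h0]
  · rfl

theorem phi_le_matInner {X : Matrix (Fin n) (Fin p) ℝ} {lam : ℝ}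
    {V : Matrix (Fin p) (Fin m) ℝ} {β z : Fin p → ℝ}
    {w : Fin p → Fin p → ℝ} {B : Matrix (Fin p) (Fin p) ℝ} (hz : ∀ i, z i ∈ Set.Icc (0 : ℝ) 1)
    (h : InnerFeasible V β z w B) :
    phi (pairs p) (gram X lam) V z β ≤ ((matInner (gram X lam) B : ℝ) : EReal) := by
  refine iSup_le fun A ↦ iSup_le fun R ↦ iSup_le fun π ↦ iSup_le fun hD ↦ ?_
  rw [coe_quad_add_sum_ratio hD hz fun i ↦ h.eq_zero_of_eq_zero]
  exact EReal.coe_le_coe_iff.2 ((h.dominates hz).le_matInner hD)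

theorem exists_innerFeasible (V : Matrix (Fin p) (Fin m) ℝ) {β z : Fin p → ℝ}
    (hz : ∀ i, z i ∈ Set.Icc (0 : ℝ) 1) (hβ : ∀ i, z i = 0 → β i = 0) :
    ∃ w B, InnerFeasible V β z w B :=
  let ⟨_, hB⟩ := exists_dominates (pairs p) V β hz
  ⟨_, _, hB.innerFeasible hz hβ⟩

theorem phi_eq_innerValue (X : Matrix (Fin n) (Fin p) ℝ) (lam : ℝ)
    {V : Matrix (Fin p) (Fin m) ℝ} (hV : ∀ j, (fun i ↦ V i j) ≠ 0) {β z : Fin p → ℝ}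
    (hz : ∀ i, z i ∈ Set.Icc (0 : ℝ) 1) (hβ : ∀ i, z i = 0 → β i = 0) :
    phi (pairs p) (gram X lam) V z β = innerValue X lam V β z := by
  refine le_antisymm (le_iInf fun w ↦ le_iInf fun B ↦ le_iInf fun h ↦ phi_le_matInner hz h) ?_
  have hle : ∀ B, Dominates (pairs p) (fun T ↦ min 1 (∑ i ∈ T, z i)) V β B →
      innerValue X lam V β z ≤ ((matInner (gram X lam) B : ℝ) : EReal) := fun B hB ↦
    (iInf_le _ _).trans ((iInf_le _ B).trans (iInf_le _ (hB.innerFeasible hz hβ)))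
  obtain ⟨B₀, hB₀⟩ := exists_dominates (pairs p) V β hz
  -- The value `⊤` is excluded by `B₀`; a finite value is reached by some decomposition.
  rcases h : innerValue X lam V β z with _ | _ | v
  · exact bot_le
  · rw [h] at hle
    exact absurd (top_le_iff.1 (hle B₀ hB₀)) (EReal.coe_ne_top _)
  · obtain ⟨A, R, π, hD, hv⟩ := exists_isDecomposition_le hV (isSymm_gram X lam) hB₀ (v := v)
      fun B hB ↦ by
        have := hle B hB
        rw [h] at this
        exact EReal.coe_le_coe_iff.1 this
    refine (EReal.coe_le_coe_iff.2 hv).trans ?_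
    rw [← coe_quad_add_sum_ratio hD hz hβ]
    exact le_iSup_of_le A (le_iSup_of_le R (le_iSup_of_le π (le_iSup_of_le hD le_rfl)))

end Reduction

/-! ### Perturbation of `z` and equality of the optimal values -/

section Values

open Filter Topology

variable {n p m : ℕ}

theorem quad_smul_right (M : Matrix (Fin p) (Fin p) ℝ) (c : ℝ) (x : Fin p → ℝ) :
    quad M (c • x) = c ^ 2 * quad M x := by
  simp only [quad, Matrix.mulVec_smul, dotProduct_smul, smul_dotProduct, smul_eq_mul]
  ring

theorem linObj_smul (X : Matrix (Fin n) (Fin p) ℝ) (y : Fin n → ℝ) (mu c : ℝ)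
    (β u : Fin p → ℝ) : linObj X y mu (c • β) (c • u) = c * linObj X y mu β u := by
  simp only [linObj, Matrix.mulVec_smul, dotProduct_smul, smul_eq_mul, Pi.smul_apply,
    ← Finset.mul_sum]
  ring

/-- The numerator shrinks by `c ^ 2` and the denominator by at most `c`. If `d = 0`, either `q = 0`
or the right side is `⊤`. -/
theorem ratio_sq_mul_le {c q d d' : ℝ} (hc : 0 < c) (hc1 : c ≤ 1) (hq : 0 ≤ q) (hd : 0 ≤ d)
    (hd' : c * d ≤ d') : ratio (c ^ 2 * q) d' ≤ ratio q d := by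
  rcases hd.eq_or_lt with rfl | hd0
  · rcases hq.eq_or_lt with rfl | hq0
    · simp [ratio]
    · simp [ratio, hq0]
  · have h0 : 0 < d' := (mul_pos hc hd0).trans_le hd'
    rw [ratio, ratio, if_neg h0.ne', if_neg hd0.ne']
    refine EReal.coe_le_coe_iff.2 ((div_le_div_iff₀ h0 hd0).2 ?_)
    have h1 : q * (c * d) ≤ q * d' := mul_le_mul_of_nonneg_left hd' hq
    have h2 : c * (q * (c * d)) ≤ 1 * (q * (c * d)) :=
      mul_le_mul_of_nonneg_right hc1 (by positivity)
    linarith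

/-- Shrinking `β` by a factor `c` does not increase `phi` if `z` does not shrink by more. -/
theorem phi_smul_le (Fam : Finset (Finset (Fin p))) (Q : Matrix (Fin p) (Fin p) ℝ)
    (V : Matrix (Fin p) (Fin m) ℝ) {z z' : Fin p → ℝ} (β : Fin p → ℝ) {c : ℝ} (hc : 0 < c)
    (hc1 : c ≤ 1) (hz : ∀ i, 0 ≤ z i) (hz' : ∀ i, c * z i ≤ z' i) :
    phi Fam Q V z' (c • β) ≤ phi Fam Q V z β := by
  refine iSup_mono fun A ↦ iSup_mono fun R ↦ iSup_mono fun π ↦ iSup_mono fun hD ↦ ?_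
  refine add_le_add ?_ (Finset.sum_le_sum fun T hT ↦ ?_)
  · rw [quad_smul_right]
    refine EReal.coe_le_coe_iff.2 (mul_le_of_le_one_left ?_ (pow_le_one₀ hc.le hc1))
    rw [hD.rem_eq, quad_mul_diagonal_mul_transpose]
    exact Finset.sum_nonneg fun j _ ↦ mul_nonneg (hD.nonneg j) (sq_nonneg _)
  · rw [quad_smul_right]
    refine ratio_sq_mul_le hc hc1 (quad_nonneg_of_posSemidef (hD.psd T hT) β)
      (le_min zero_le_one (Finset.sum_nonneg fun i _ ↦ hz i)) (le_min ?_ ?_)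
    · exact mul_le_one₀ hc1 (le_min zero_le_one (Finset.sum_nonneg fun i _ ↦ hz i))
        (min_le_left _ _)
    · refine (mul_le_mul_of_nonneg_left (min_le_right _ _) hc.le).trans ?_
      rw [Finset.mul_sum]
      exact Finset.sum_le_sum fun i _ ↦ hz' i

theorem relaxObj_le_sdpObj {X : Matrix (Fin n) (Fin p) ℝ} {y : Fin n → ℝ} {lam mu : ℝ}
    {V : Matrix (Fin p) (Fin m) ℝ} {β z u : Fin p → ℝ}
    {w : Fin p → Fin p → ℝ} {B : Matrix (Fin p) (Fin p) ℝ} (hz : ∀ i, z i ∈ Set.Icc (0 : ℝ) 1)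
    (h : InnerFeasible V β z w B) :
    relaxObj X y lam mu (pairs p) V β z u ≤ ((sdpObj X y lam mu β u B : ℝ) : EReal) := by
  rw [relaxObj, sdpObj, EReal.coe_add _ (matInner _ _)]
  exact add_le_add le_rfl (phi_le_matInner hz h)

theorem sdpValue_le_relaxObj {X : Matrix (Fin n) (Fin p) ℝ} {y : Fin n → ℝ} {lam mu : ℝ} {k : ℕ}
    {V : Matrix (Fin p) (Fin m) ℝ} (hV : ∀ j, (fun i ↦ V i j) ≠ 0) {β z u : Fin p → ℝ}
    (h : BaseFeasible k β z u) (hβ : ∀ i, z i = 0 → β i = 0) :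
    sdpValue X y lam mu k V ≤ relaxObj X y lam mu (pairs p) V β z u := by
  rw [relaxObj, phi_eq_innerValue X lam hV h.z_mem hβ, add_comm,
    ← EReal.sub_le_iff_le_add (.inl (EReal.coe_ne_bot _)) (.inl (EReal.coe_ne_top _))]
  refine le_iInf fun w ↦ le_iInf fun B ↦ le_iInf fun hB ↦ ?_
  rw [EReal.sub_le_iff_le_add (.inl (EReal.coe_ne_bot _)) (.inl (EReal.coe_ne_top _)),
    ← EReal.coe_add, add_comm]
  exact iInf_le_of_le β (iInf_le_of_le z (iInf_le_of_le u (iInf_le_of_le w (iInf_le_of_le B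
    (iInf_le_of_le h (iInf_le_of_le hB le_rfl))))))

/-- The point `(β, z, u)` pulled towards `(0, 1 / (p + 1), 0)`. -/
theorem BaseFeasible.shrink {k : ℕ} (hk : 1 ≤ k) {β z u : Fin p → ℝ} (h : BaseFeasible k β z u)
    {c : ℝ} (hc : 0 ≤ c) (hc1 : c ≤ 1) :
    BaseFeasible k (c • β) (fun i ↦ c * z i + (1 - c) / (p + 1)) (c • u) := by
  have hp : (0 : ℝ) < p + 1 := by positivity
  have hc' : 0 ≤ 1 - c := by linarith
  have hk' : (1 : ℝ) ≤ k := by exact_mod_cast hk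
  refine ⟨?_, fun i ↦ mul_le_mul_of_nonneg_left (h.le_u i) hc, fun i ↦ ?_, fun i ↦ ⟨?_, ?_⟩,
    fun i ↦ mul_nonneg hc (h.u_nonneg i)⟩
  · rw [Finset.sum_add_distrib, ← Finset.mul_sum, Finset.sum_const, Finset.card_univ,
      Fintype.card_fin, nsmul_eq_mul]
    -- The mass added to `z` is at most `1 - c`, and `c k + (1 - c) ≤ k` because `k ≥ 1`.
    have h1 : (p : ℝ) * ((1 - c) / (p + 1)) ≤ 1 - c := by
      rw [mul_div_assoc', div_le_iff₀ hp]
      linarith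
    have h2 := mul_le_mul_of_nonneg_left h.card hc
    nlinarith
  · have := mul_le_mul_of_nonneg_left (h.neg_le_u i) hc
    simpa using this
  · have := mul_nonneg hc (h.z_mem i).1
    positivity
  · have h1 : (1 - c) / (p + 1) ≤ 1 - c := div_le_self hc' (by linarith)
    have h2 := mul_le_mul_of_nonneg_left (h.z_mem i).2 hc
    linarith

theorem relaxValue_eq_sdpValue (X : Matrix (Fin n) (Fin p) ℝ) (y : Fin n → ℝ) (lam mu : ℝ) {k : ℕ}
    (hk : 1 ≤ k) {V : Matrix (Fin p) (Fin m) ℝ} (hV : ∀ j, (fun i ↦ V i j) ≠ 0) :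
    relaxValue X y lam mu k (pairs p) V = sdpValue X y lam mu k V := by
  refine le_antisymm ?_ ?_
  · refine le_iInf fun β ↦ le_iInf fun z ↦ le_iInf fun u ↦ le_iInf fun w ↦ le_iInf fun B ↦
      le_iInf fun h ↦ le_iInf fun hB ↦ ?_
    exact iInf_le_of_le β (iInf_le_of_le z (iInf_le_of_le u (iInf_le_of_le h
      (relaxObj_le_sdpObj h.z_mem hB))))
  · refine le_iInf fun β ↦ le_iInf fun z ↦ le_iInf fun u ↦ le_iInf fun h ↦ ?_
    -- Only the linear part varies with `c`; `phi` stays at the original point and bounds its value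
    -- at the shrunken one, so no continuity of `phi` is needed.
    have hlim : Tendsto (fun c : ℝ ↦ ((y ⬝ᵥ y + c * linObj X y mu β u : ℝ) : EReal)
        + phi (pairs p) (gram X lam) V z β) (𝓝[<] 1)
        (𝓝 (relaxObj X y lam mu (pairs p) V β z u)) := by
      have h1 : Tendsto (fun c : ℝ ↦ ((y ⬝ᵥ y + c * linObj X y mu β u : ℝ) : EReal)) (𝓝[<] 1)
          (𝓝 ((y ⬝ᵥ y + linObj X y mu β u : ℝ) : EReal)) := by
        refine (continuous_coe_real_ereal.tendsto _).comp (tendsto_nhdsWithin_of_tendsto_nhds ?_)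
        have : Continuous fun c : ℝ ↦ y ⬝ᵥ y + c * linObj X y mu β u := by fun_prop
        simpa using this.tendsto 1
      exact (EReal.continuousAt_add (p := (_, _)) (.inl (EReal.coe_ne_top _))
        (.inl (EReal.coe_ne_bot _))).tendsto.comp (h1.prodMk_nhds tendsto_const_nhds)
    refine ge_of_tendsto hlim ?_
    filter_upwards [Ioo_mem_nhdsLT (zero_lt_one' ℝ)] with c hc
    have hpos : 0 < (1 - c) / ((p : ℝ) + 1) := div_pos (by linarith [hc.2]) (by positivity)
    refine (sdpValue_le_relaxObj hV (h.shrink hk hc.1.le hc.2.le) fun i hi ↦ ?_).trans ?_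
    · have := mul_nonneg hc.1.le (h.z_mem i).1
      linarith
    · rw [relaxObj, linObj_smul]
      exact add_le_add le_rfl (phi_smul_le _ _ _ _ hc.1 hc.2.le (fun i ↦ (h.z_mem i).1)
        fun i ↦ by linarith)

end Values

end SparseReg

theorem proposition7 {n p : ℕ} (X : Matrix (Fin n) (Fin p) ℝ) (y : Fin n → ℝ)
    (lam mu : ℝ) (hlam : 0 ≤ lam) (hmu : 0 ≤ mu) (k : ℕ) (hk : 1 ≤ k)
    (V : Matrix (Fin p) (Fin (min n p)) ℝ)
    (hV : ∀ j, ∃ d : ℝ,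
      Module.End.HasEigenvector (Matrix.toLin' (Xᵀ * X)) d (fun i => V i j)) :
    -- the two problems have the same optimal value
    SparseReg.relaxValue X y lam mu k (SparseReg.pairs p) V
        = SparseReg.sdpValue X y lam mu k V ∧
    -- minimizing out `(w, B)` gives `φ` wherever `(β, z)` extends to a feasible `(w, B)`
    (∀ β z : Fin p → ℝ, (∀ i, z i ∈ Set.Icc (0 : ℝ) 1) → (∀ i, z i = 0 → β i = 0) →
      (∃ w B, SparseReg.InnerFeasible V β z w B) ∧
      SparseReg.phi (SparseReg.pairs p) (SparseReg.gram X lam) V z β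
        = SparseReg.innerValue X lam V β z) ∧
    -- every optimal solution of `SDP_LB` projects to one of the relaxation
    (∀ (β z u : Fin p → ℝ) (w : Fin p → Fin p → ℝ) (B : Matrix (Fin p) (Fin p) ℝ),
      SparseReg.BaseFeasible k β z u → SparseReg.InnerFeasible V β z w B →
      ((SparseReg.sdpObj X y lam mu β u B : ℝ) : EReal) = SparseReg.sdpValue X y lam mu k V →
      SparseReg.relaxObj X y lam mu (SparseReg.pairs p) V β z u
        = SparseReg.relaxValue X y lam mu k (SparseReg.pairs p) V) := by
  -- Eigenvectors are nonzero, as the closedness argument requires.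
  have hV0 : ∀ j, (fun i ↦ V i j) ≠ 0 := fun j ↦ (hV j).choose_spec.2
  have hval := SparseReg.relaxValue_eq_sdpValue X y lam mu hk hV0
  refine ⟨hval, fun β z hz hβ ↦ ⟨SparseReg.exists_innerFeasible V hz hβ,
    SparseReg.phi_eq_innerValue X lam hV0 hz hβ⟩, fun β z u w B h hB hopt ↦ le_antisymm ?_ ?_⟩
  · rw [hval, ← hopt]
    exact SparseReg.relaxObj_le_sdpObj h.z_mem hB
  · exact iInf_le_of_le β (iInf_le_of_le z (iInf_le_of_le u (iInf_le_of_le h le_rfl)))
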